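/- An MV-algebra is an algebra $(A,\oplus,\neg,0)$ of type $(2,1,0)$ such that, with $1:=\neg 0$, for all $x,y,z\in A$: $x\oplus y=y\oplus x$; $x\oplus(y\oplus z)=(x\oplus y)\oplus z$; $x\oplus 0=x$; $\neg\neg x=x$; $x\oplus 1=1$; and $\neg(\neg x\oplus y)\oplus y=\neg(\neg y\oplus x)\oplus x$. It is ordered by $x\le y\iff\neg x\oplus y=1$; an MV-chain is an MV-algebra that is linearly ordered by $\le$ (the one-element algebra is allowed). An embedding is an injective map preserving $\oplus$, $\neg$ and $0$. Products and powers of MV-algebras carry componentwise operations, and the ultraproduct of a family $(A_i)_{i\in I}$ of MV-algebras over an ultrafilter $U$ on $I$ is the quotient of $\prod_{i\in I}A_i$ by the congruence $x\sim y\iff\{i\in I : x(i)=y(i)\}\in U$. **Theorem.** 1. Every linearly ordered MV-algebra can be embedded into an ultraproduct of finite MV-chains. 2. Every MV-algebra can be embedded into a product of ultraproducts of finite MV-chains. 3. Every MV-algebra can be embedded into an ultraproduct of finite MV-algebras, each of which can be embedded into a power of a finite MV-chain. -/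

import Mathlib

/-- An MV-algebra: an algebra `(A, ⊕, ¬, 0)` of type `(2, 1, 0)` satisfying the six
usual axioms, where `1 := ¬ 0`. -/
class MVAlgebra (A : Type*) where
  oplus : A → A → A
  neg : A → A
  zero : A
  oplus_comm : ∀ x y : A, oplus x y = oplus y x
  oplus_assoc : ∀ x y z : A, oplus x (oplus y z) = oplus (oplus x y) z
  oplus_zero : ∀ x : A, oplus x zero = x
  neg_neg : ∀ x : A, neg (neg x) = x
  oplus_one : ∀ x : A, oplus x (neg zero) = neg zero
  lukasiewicz : ∀ x y : A,
    oplus (neg (oplus (neg x) y)) y = oplus (neg (oplus (neg y) x)) x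

universe u

namespace MVAlgebra

/-- The constant `1 = ¬ 0`. -/
def one {A : Type*} [MVAlgebra A] : A := neg zero

/-- The natural order: `x ≤ y` iff `¬ x ⊕ y = 1`. -/
def le {A : Type*} [MVAlgebra A] (x y : A) : Prop := oplus (neg x) y = one

/-- `A` is an MV-chain (a linearly ordered MV-algebra): its natural order is total. -/
def IsMVChain (A : Type*) [MVAlgebra A] : Prop := ∀ x y : A, le x y ∨ le y x

/-- `f` is an embedding of MV-algebras: an injective map preserving `⊕`, `¬` and `0`. -/
structure IsEmbedding {A B : Type*} [MVAlgebra A] [MVAlgebra B] (f : A → B) : Prop where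
  injective : Function.Injective f
  map_oplus : ∀ x y : A, f (oplus x y) = oplus (f x) (f y)
  map_neg : ∀ x : A, f (neg x) = neg (f x)
  map_zero : f zero = zero

/-- `A` can be embedded into `B`. -/
def EmbedsInto (A B : Type*) [MVAlgebra A] [MVAlgebra B] : Prop :=
  ∃ f : A → B, IsEmbedding f

/-- The direct product of a family of MV-algebras, with componentwise operations
(for a constant family this is a power). -/
instance instPi {I : Type*} (A : I → Type*) [∀ i, MVAlgebra (A i)] :
    MVAlgebra (∀ i, A i) where
  oplus x y := fun i => oplus (x i) (y i)
  neg x := fun i => neg (x i)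
  zero := fun _ => zero
  oplus_comm x y := funext fun i => oplus_comm (x i) (y i)
  oplus_assoc x y z := funext fun i => oplus_assoc (x i) (y i) (z i)
  oplus_zero x := funext fun i => oplus_zero (x i)
  neg_neg x := funext fun i => neg_neg (x i)
  oplus_one x := funext fun i => oplus_one (x i)
  lukasiewicz x y := funext fun i => lukasiewicz (x i) (y i)

/-- The reduced product of a family of MV-algebras modulo a filter `F` on the index set,
i.e. the quotient of the direct product by the congruence
`x ~ y ↔ {i | x i = y i} ∈ F`, with the operations induced by the direct product. -/
instance instReducedProduct {I : Type*} (F : Filter I) (A : I → Type*)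
    [∀ i, MVAlgebra (A i)] : MVAlgebra (F.Product A) where
  oplus := Quotient.map₂ (sa := F.productSetoid A) (sb := F.productSetoid A)
    (sc := F.productSetoid A) (fun x y => oplus x y) (by
      intro x x' hx y y' hy
      filter_upwards [hx, hy] with i h1 h2
      exact congrArg₂ oplus h1 h2)
  neg := Quotient.map (sa := F.productSetoid A) (sb := F.productSetoid A)
    (fun x => neg x) (by
      intro x x' hx
      filter_upwards [hx] with i h1
      exact congrArg neg h1)
  zero := Quotient.mk (F.productSetoid A) zero
  oplus_comm := by
    rintro ⟨x⟩ ⟨y⟩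
    exact congrArg (Quotient.mk (F.productSetoid A)) (oplus_comm x y)
  oplus_assoc := by
    rintro ⟨x⟩ ⟨y⟩ ⟨z⟩
    exact congrArg (Quotient.mk (F.productSetoid A)) (oplus_assoc x y z)
  oplus_zero := by
    rintro ⟨x⟩
    exact congrArg (Quotient.mk (F.productSetoid A)) (oplus_zero x)
  neg_neg := by
    rintro ⟨x⟩
    exact congrArg (Quotient.mk (F.productSetoid A)) (neg_neg x)
  oplus_one := by
    rintro ⟨x⟩
    exact congrArg (Quotient.mk (F.productSetoid A)) (oplus_one x)
  lukasiewicz := by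
    rintro ⟨x⟩ ⟨y⟩
    exact congrArg (Quotient.mk (F.productSetoid A)) (lukasiewicz x y)

/-- The ultraproduct of a family of MV-algebras: the reduced product modulo an ultrafilter. -/
abbrev Ultraproduct {I : Type*} (U : Ultrafilter I) (A : I → Type*) : Type _ :=
  (U : Filter I).Product A

end MVAlgebra

/-! The ultraproducts are local: an algebra embeds in an ultraproduct of a family once each finite
subset `S` is mapped injectively into a member by a map respecting the operations whenever the
results stay in `S`. The index set is the set of finite subsets, with an ultrafilter containing
every `{S | x ∈ S}` (`embedsInto_ultraproduct`).

For a nontrivial chain, adjoining integer parts yields a linearly ordered abelian group with a unit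
`u` (Chang's group) in which the chain sits between `0` and `u`, with truncated addition. Finitely
many strict inequalities in such a group survive under some additive map to `ℚ`, by Fourier–Motzkin
elimination (`exists_rat_solution`). Dividing by the image of `u` and clearing denominators puts a
finite part of the chain into `{0, …, N}` (`IsMVChain.exists_partial_embedding`).

For a general algebra, quotients by prime ideals are chains and separate points. Using one quotient
per pair of distinct points gives the product of ultraproducts; doing this for the points of a
finite part, with a common denominator, gives a power of one finite chain. -/

namespace MVAlgebra

/-! ### Arithmetic and lattice order of MV-algebras -/

section Basic

variable {A : Type*} [MVAlgebra A]

local infixl:65 " ∔ " => oplus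

/-- The product `x ⊙ y = ¬(¬x ⊕ ¬y)`. -/
def odot (x y : A) : A := neg (neg x ∔ neg y)

local infixl:70 " ⊡ " => odot

theorem neg_injective : Function.Injective (neg : A → A) := fun x y h => by
  rw [← neg_neg x, h, neg_neg]

theorem neg_zero : neg (zero : A) = one := rfl

theorem neg_one : neg (one : A) = zero := neg_neg zero

theorem zero_oplus (x : A) : zero ∔ x = x := by rw [oplus_comm, oplus_zero]

theorem oplus_one' (x : A) : x ∔ one = one := oplus_one x

theorem one_oplus (x : A) : one ∔ x = one := by rw [oplus_comm, oplus_one']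

theorem neg_oplus_self (x : A) : neg x ∔ x = one := by
  have h := lukasiewicz x one
  rw [oplus_one', neg_one, zero_oplus] at h
  exact h.symm

theorem oplus_neg_self (x : A) : x ∔ neg x = one := by rw [oplus_comm, neg_oplus_self]

theorem odot_comm (x y : A) : x ⊡ y = y ⊡ x := by rw [odot, oplus_comm]; rfl

theorem neg_odot (x y : A) : neg (x ⊡ y) = neg x ∔ neg y := neg_neg _

theorem neg_oplus (x y : A) : neg (x ∔ y) = neg x ⊡ neg y := by
  rw [odot, neg_neg, neg_neg]

theorem odot_assoc (x y z : A) : x ⊡ (y ⊡ z) = x ⊡ y ⊡ z := by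
  apply neg_injective
  simp only [neg_odot, oplus_assoc]

theorem odot_one (x : A) : x ⊡ one = x := by
  apply neg_injective
  rw [neg_odot, neg_one, oplus_zero]

theorem odot_zero (x : A) : x ⊡ zero = zero := by
  apply neg_injective
  rw [neg_odot, neg_zero, oplus_one']

theorem odot_neg_self (x : A) : x ⊡ neg x = zero := by
  apply neg_injective
  rw [neg_odot, oplus_neg_self, neg_zero]

theorem oplus_right_comm (x y z : A) : x ∔ y ∔ z = x ∔ z ∔ y := by
  rw [← oplus_assoc, oplus_comm y z, oplus_assoc]

theorem le_antisymm' {x y : A} (h₁ : le x y) (h₂ : le y x) : x = y := by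
  have h := lukasiewicz x y
  rw [le] at h₁ h₂
  rw [h₁, h₂, neg_one, zero_oplus, zero_oplus] at h
  exact h.symm

/-- The Łukasiewicz axiom loses one side when `le x y`. Here `y ⊡ neg x` is the truncated
difference, so an inequality becomes an equation that can be rewritten with. -/
theorem oplus_odot_neg_of_le {x y : A} (h : le x y) : x ∔ (y ⊡ neg x) = y := by
  have h' := lukasiewicz x y
  rw [le] at h
  rw [h, neg_one, zero_oplus] at h'
  rw [oplus_comm, odot, neg_neg, ← h']

theorem le_oplus (x z : A) : le x (x ∔ z) := by
  rw [le, oplus_assoc, neg_oplus_self, one_oplus]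

theorem le_trans' {x y z : A} (h₁ : le x y) (h₂ : le y z) : le x z := by
  rw [← oplus_odot_neg_of_le h₂, ← oplus_odot_neg_of_le h₁, ← oplus_assoc]
  exact le_oplus _ _

/-- Residuation: after unfolding, both sides are the same sum up to associativity. -/
theorem odot_le_iff {x y z : A} : le (x ⊡ y) z ↔ le x (neg y ∔ z) := by
  rw [le, le, neg_odot, oplus_assoc]

theorem odot_neg_le_iff {x y z : A} : le (x ⊡ neg y) z ↔ le x (y ∔ z) := by
  rw [odot_le_iff, neg_neg]

theorem le_join (x y : A) : le x (y ∔ (x ⊡ neg y)) := odot_neg_le_iff.1 (neg_oplus_self _)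

theorem neg_le_neg_iff' {x y : A} : le (neg x) (neg y) ↔ le y x := by
  rw [le, le, neg_neg, oplus_comm]

theorem oplus_le_oplus_left' {x y : A} (h : le x y) (z : A) : le (z ∔ x) (z ∔ y) := by
  rw [← oplus_odot_neg_of_le h, oplus_assoc]
  exact le_oplus _ _

theorem odot_le_odot_left' {x y : A} (h : le x y) (z : A) : le (z ⊡ x) (z ⊡ y) := by
  rw [← neg_le_neg_iff', neg_odot, neg_odot]
  exact oplus_le_oplus_left' (neg_le_neg_iff'.2 h) _

/-- The lattice structure of an MV-algebra. -/
abbrev toLattice : Lattice A where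
  le := le
  le_refl := neg_oplus_self
  le_trans _ _ _ := le_trans'
  le_antisymm _ _ := le_antisymm'
  sup x y := x ∔ (y ⊡ neg x)
  -- The De Morgan dual of the join, so that the meet laws are join laws for negations.
  inf x y := neg (neg x ∔ (neg y ⊡ neg (neg x)))
  le_sup_left _ _ := le_oplus _ _
  le_sup_right x y := le_join y x
  sup_le x y z hx hy := by
    rw [← oplus_odot_neg_of_le hx]
    refine oplus_le_oplus_left' ?_ _
    rw [odot_comm y, odot_comm z]
    exact odot_le_odot_left' hy _
  inf_le_left x y := by
    rw [← neg_le_neg_iff', neg_neg]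
    exact le_oplus _ _
  inf_le_right x y := by
    rw [← neg_le_neg_iff', neg_neg]
    exact le_join _ _
  le_inf x y z hy hz := by
    rw [← neg_le_neg_iff', neg_neg]
    rw [← neg_le_neg_iff'] at hy hz
    rw [← oplus_odot_neg_of_le hy]
    refine oplus_le_oplus_left' ?_ _
    rw [odot_comm (neg z), odot_comm (neg x)]
    exact odot_le_odot_left' hz _

attribute [local instance] toLattice

theorem le_def {x y : A} : x ≤ y ↔ neg x ∔ y = one := Iff.rfl

theorem zero_le' (x : A) : zero ≤ x := by
  rw [le_def, neg_zero, one_oplus]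

theorem le_one' (x : A) : x ≤ one := oplus_one' _

theorem le_zero_iff {x : A} : x ≤ zero ↔ x = zero :=
  ⟨fun h => le_antisymm h (zero_le' x), fun h => h.le⟩

theorem one_le_iff {x : A} : one ≤ x ↔ x = one :=
  ⟨fun h => le_antisymm (le_one' x) h, fun h => h.ge⟩

theorem oplus_le_oplus {x y z w : A} (h₁ : x ≤ y) (h₂ : z ≤ w) : x ∔ z ≤ y ∔ w := by
  refine le_trans (oplus_le_oplus_left' h₂ x) ?_
  rw [oplus_comm x, oplus_comm y]
  exact oplus_le_oplus_left' h₁ w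

theorem odot_le_odot {x y z w : A} (h₁ : x ≤ y) (h₂ : z ≤ w) : x ⊡ z ≤ y ⊡ w := by
  refine le_trans (odot_le_odot_left' h₂ x) ?_
  rw [odot_comm x, odot_comm y]
  exact odot_le_odot_left' h₁ w

theorem le_oplus_left (x y : A) : x ≤ x ∔ y := le_oplus x y

theorem le_oplus_right (x y : A) : y ≤ x ∔ y := by
  rw [oplus_comm]; exact le_oplus y x

theorem neg_le_neg_of_le {x y : A} (h : x ≤ y) : neg y ≤ neg x := neg_le_neg_iff'.2 h

theorem odot_le_left (x y : A) : x ⊡ y ≤ x := by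
  simpa only [odot_one] using odot_le_odot (le_refl x) (le_one' y)

theorem odot_le_right (x y : A) : x ⊡ y ≤ y := by
  rw [odot_comm]; exact odot_le_left y x

theorem sub_le_iff {x y z : A} : x ⊡ neg y ≤ z ↔ x ≤ y ∔ z := odot_neg_le_iff

theorem sub_eq_zero_iff {x y : A} : x ⊡ neg y = zero ↔ x ≤ y := by
  rw [← le_zero_iff, sub_le_iff, oplus_zero]

theorem odot_eq_zero_iff {x y : A} : x ⊡ y = zero ↔ x ≤ neg y := by
  rw [← sub_eq_zero_iff, neg_neg]

theorem oplus_eq_one_iff {x y : A} : x ∔ y = one ↔ neg x ≤ y := by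
  rw [le_def, neg_neg]

theorem oplus_sub_of_le {x y : A} (h : x ≤ y) : x ∔ (y ⊡ neg x) = y := oplus_odot_neg_of_le h

/-- When `y ≤ neg x` the sum is not truncated, so subtracting `x` undoes it; this is the negated
form of `oplus_sub_of_le`. -/
theorem oplus_odot_cancel {x y : A} (h : y ≤ neg x) : (x ∔ y) ⊡ neg x = y := by
  have := oplus_sub_of_le (neg_le_neg_of_le h)
  apply neg_injective
  rw [neg_odot, neg_oplus, oplus_comm, odot_comm]
  simpa only [neg_neg] using this

/-- `x ⊖ y` and `y ⊖ x` are disjoint. -/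
theorem sub_inf_sub (x y : A) : (x ⊡ neg y) ⊓ (y ⊡ neg x) = zero := by
  set t := (x ⊡ neg y) ⊓ (y ⊡ neg x)
  have key : ∀ a b : A, t ≤ a ⊡ neg b → (a ⊓ b) ∔ t ≤ a := fun a b h => by
    have h' : t ≤ a ⊡ neg (a ⊓ b) :=
      h.trans (odot_le_odot le_rfl (neg_le_neg_of_le inf_le_right))
    exact (oplus_le_oplus le_rfl h').trans (oplus_sub_of_le inf_le_left).le
  have h₁ := key x y inf_le_left
  have h₂ := key y x inf_le_right
  rw [inf_comm] at h₂
  -- Adding `t` to the meet does not leave the meet, and `h₄` says that this addition is not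
  -- truncated; cancelling forces `t = zero`.
  have h₃ : (x ⊓ y) ∔ t ≤ x ⊓ y := le_inf h₁ h₂
  have h₄ : t ≤ neg (x ⊓ y) :=
    (inf_le_left.trans (odot_le_right _ _)).trans (neg_le_neg_of_le inf_le_right)
  rw [← oplus_odot_cancel h₄, sub_eq_zero_iff]
  exact h₃

theorem inf_oplus_eq_zero {x y z : A} (hy : x ⊓ y = zero) (hz : x ⊓ z = zero) :
    x ⊓ (y ∔ z) = zero := by
  set t := x ⊓ (y ∔ z)
  have h₁ : t ⊡ neg y ≤ z := sub_le_iff.2 inf_le_right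
  have h₂ : t ⊡ neg y ≤ x ⊓ z := le_inf ((odot_le_left _ _).trans inf_le_left) h₁
  rw [hz, le_zero_iff, sub_eq_zero_iff] at h₂
  have h₃ : t ≤ x ⊓ y := le_inf inf_le_left h₂
  rwa [hy, le_zero_iff] at h₃

/-! ### Ideals, quotients and separation of points by chains -/

/-- Ideals of an MV-algebra. -/
structure IsIdeal (I : Set A) : Prop where
  zero_mem : zero ∈ I
  mem_of_le : ∀ {x y : A}, x ≤ y → y ∈ I → x ∈ I
  oplus_mem : ∀ {x y : A}, x ∈ I → y ∈ I → x ∔ y ∈ I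

/-- The polar of a set: the elements disjoint from all its members. -/
def polar (S : Set A) : Set A := {x | ∀ y ∈ S, y ⊓ x = zero}

theorem isIdeal_polar (S : Set A) : IsIdeal (polar S) where
  zero_mem y _ := inf_eq_right.2 (zero_le' y)
  mem_of_le {x z} h hz y hy := le_zero_iff.1 (by
    rw [← hz y hy]; exact inf_le_inf le_rfl h)
  oplus_mem hx hz y hy := inf_oplus_eq_zero (hx y hy) (hz y hy)

/-- The ideal generated by two ideals. -/
def idealJoin (I J : Set A) : Set A := {x | ∃ i ∈ I, ∃ j ∈ J, x ≤ i ∔ j}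

theorem IsIdeal.join {I J : Set A} (hI : IsIdeal I) (hJ : IsIdeal J) :
    IsIdeal (idealJoin I J) where
  zero_mem := ⟨zero, hI.zero_mem, zero, hJ.zero_mem, zero_le' _⟩
  mem_of_le := by
    rintro x y h ⟨i, hi, j, hj, hy⟩
    exact ⟨i, hi, j, hj, h.trans hy⟩
  oplus_mem := by
    rintro x y ⟨i, hi, j, hj, hx⟩ ⟨i', hi', j', hj', hy⟩
    refine ⟨i ∔ i', hI.oplus_mem hi hi', j ∔ j', hJ.oplus_mem hj hj', ?_⟩
    refine (oplus_le_oplus hx hy).trans (le_of_eq ?_)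
    rw [oplus_assoc, oplus_assoc, oplus_right_comm i j i']

/-- Every nonzero element is missed by some prime ideal. -/
theorem exists_prime_ideal {a : A} (ha : a ≠ zero) :
    ∃ I : Set A, IsIdeal I ∧ a ∉ I ∧ ∀ x y : A, x ⊡ neg y ∈ I ∨ y ⊡ neg x ∈ I := by
  have chain_bound : ∀ c ⊆ {I : Set A | IsIdeal I ∧ a ∉ I}, IsChain (· ⊆ ·) c → c.Nonempty →
      ∃ ub ∈ {I : Set A | IsIdeal I ∧ a ∉ I}, ∀ s ∈ c, s ⊆ ub := by
    intro c hc hchain hne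
    refine ⟨⋃₀ c, ⟨⟨?_, ?_, ?_⟩, ?_⟩, fun s hs => Set.subset_sUnion_of_mem hs⟩
    · obtain ⟨s, hs⟩ := hne
      exact ⟨s, hs, (hc hs).1.zero_mem⟩
    · rintro x y h ⟨s, hs, hy⟩
      exact ⟨s, hs, (hc hs).1.mem_of_le h hy⟩
    · rintro x y ⟨s, hs, hx⟩ ⟨t, ht, hy⟩
      rcases hchain.total hs ht with h | h
      · exact ⟨t, ht, (hc ht).1.oplus_mem (h hx) hy⟩
      · exact ⟨s, hs, (hc hs).1.oplus_mem hx (h hy)⟩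
    · rintro ⟨s, hs, h⟩
      exact (hc hs).2 h
  obtain ⟨I, -, ⟨hI, haI⟩, hmax⟩ := zorn_subset_nonempty _ chain_bound
    {zero} ⟨⟨rfl, fun h hy => le_zero_iff.1 (h.trans_eq hy), fun hx hy => by
      rw [Set.mem_singleton_iff] at *; rw [hx, hy, oplus_zero]⟩, ha⟩
  refine ⟨I, hI, haI, fun x y => ?_⟩
  -- Bipolars replace principal ideals: they contain the generator, are ideals without any iterated
  -- sums, and the bipolars of disjoint elements are disjoint. Maximality of `I` forces `a` into the
  -- enlarged ideal.
  have gen : ∀ u : A, u ∉ I → a ∈ idealJoin I (polar (polar {u})) := fun u hu => by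
    by_contra hcon
    have hle : I ≤ idealJoin I (polar (polar {u})) := fun i hi =>
      ⟨i, hi, zero, (isIdeal_polar _).zero_mem, le_oplus_left _ _⟩
    refine hu (hmax ⟨hI.join (isIdeal_polar _), hcon⟩ hle
      ⟨zero, hI.zero_mem, u, fun v hv => ?_, le_oplus_right _ _⟩)
    rw [inf_comm]
    exact hv u rfl
  by_contra! hcon
  obtain ⟨i, hi, p, hp, h₁⟩ := gen _ hcon.1
  obtain ⟨j, hj, q, hq, h₂⟩ := gen _ hcon.2
  refine haI (hI.mem_of_le ?_ (hI.oplus_mem hi hj))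
  have hpq : q ⊓ p = zero := by
    refine hp _ fun w hw => ?_
    obtain rfl : w = x ⊡ neg y := hw
    refine hq _ fun w hw => ?_
    obtain rfl : w = y ⊡ neg x := hw
    rw [inf_comm, sub_inf_sub]
  -- The difference of `a` and `i ∔ j` lies below both `p` and `q`, hence vanishes.
  rw [← sub_eq_zero_iff, ← le_zero_iff, ← hpq]
  refine le_inf (sub_le_iff.2 (h₂.trans (oplus_le_oplus (le_oplus_right _ _) le_rfl)))
    (sub_le_iff.2 (h₁.trans (oplus_le_oplus (le_oplus_left _ _) le_rfl)))

theorem sub_triangle (x y z : A) : x ⊡ neg z ≤ (y ⊡ neg z) ∔ (x ⊡ neg y) := by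
  rw [sub_le_iff, oplus_assoc]
  exact le_trans (le_join x y) (oplus_le_oplus (le_join y z) le_rfl)

theorem oplus_sub_oplus_le (x y z : A) : (x ∔ z) ⊡ neg (y ∔ z) ≤ x ⊡ neg y := by
  rw [sub_le_iff, oplus_right_comm]
  exact oplus_le_oplus (le_join x y) le_rfl

/-- The congruence of an ideal. -/
def IsIdeal.setoid {I : Set A} (hI : IsIdeal I) : Setoid A where
  r x y := x ⊡ neg y ∈ I ∧ y ⊡ neg x ∈ I
  iseqv :=
    { refl := fun x => by rw [odot_neg_self]; exact ⟨hI.zero_mem, hI.zero_mem⟩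
      symm := fun h => ⟨h.2, h.1⟩
      trans := fun {x y z} h h' =>
        ⟨hI.mem_of_le (sub_triangle x y z) (hI.oplus_mem h'.1 h.1),
          hI.mem_of_le (sub_triangle z y x) (hI.oplus_mem h.2 h'.2)⟩ }

theorem IsIdeal.oplus_rel {I : Set A} (hI : IsIdeal I) {x x' y y' : A}
    (hx : hI.setoid x x') (hy : hI.setoid y y') : hI.setoid (x ∔ y) (x' ∔ y') := by
  have key : ∀ {x x' : A} (y : A), hI.setoid x x' → hI.setoid (x ∔ y) (x' ∔ y) :=
    fun y h => ⟨hI.mem_of_le (oplus_sub_oplus_le _ _ y) h.1,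
      hI.mem_of_le (oplus_sub_oplus_le _ _ y) h.2⟩
  refine hI.setoid.trans (key y hx) ?_
  rw [oplus_comm x', oplus_comm x']
  exact key x' hy

theorem IsIdeal.neg_rel {I : Set A} (hI : IsIdeal I) {x x' : A}
    (hx : hI.setoid x x') : hI.setoid (neg x) (neg x') := by
  change neg x ⊡ neg (neg x') ∈ I ∧ neg x' ⊡ neg (neg x) ∈ I
  rw [neg_neg, neg_neg, odot_comm, odot_comm (neg x')]
  exact ⟨hx.2, hx.1⟩

/-- The quotient of an MV-algebra by an ideal. -/
@[reducible] def IsIdeal.quotient {I : Set A} (hI : IsIdeal I) : MVAlgebra (Quotient hI.setoid) where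
  oplus := Quotient.map₂ oplus fun _ _ h _ _ h' => hI.oplus_rel h h'
  neg := Quotient.map neg fun _ _ h => hI.neg_rel h
  zero := ⟦zero⟧
  oplus_comm := by rintro ⟨x⟩ ⟨y⟩; exact congrArg (Quotient.mk _) (oplus_comm x y)
  oplus_assoc := by rintro ⟨x⟩ ⟨y⟩ ⟨z⟩; exact congrArg (Quotient.mk _) (oplus_assoc x y z)
  oplus_zero := by rintro ⟨x⟩; exact congrArg (Quotient.mk _) (oplus_zero x)
  neg_neg := by rintro ⟨x⟩; exact congrArg (Quotient.mk _) (neg_neg x)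
  oplus_one := by rintro ⟨x⟩; exact congrArg (Quotient.mk _) (oplus_one x)
  lukasiewicz := by rintro ⟨x⟩ ⟨y⟩; exact congrArg (Quotient.mk _) (lukasiewicz x y)

end Basic

/-- Homomorphisms of MV-algebras. -/
structure IsHom {A B : Type*} [MVAlgebra A] [MVAlgebra B] (f : A → B) : Prop where
  map_oplus : ∀ x y : A, f (oplus x y) = oplus (f x) (f y)
  map_neg : ∀ x : A, f (neg x) = neg (f x)
  map_zero : f zero = zero

/-- Homomorphisms to MV-chains separate the points of an MV-algebra. -/
theorem exists_isHom_chain_ne {A : Type u} [MVAlgebra A] {x y : A} (hxy : x ≠ y) :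
    ∃ (C : Type u) (_ : MVAlgebra C) (f : A → C), IsMVChain C ∧ IsHom f ∧ f x ≠ f y := by
  let _ : Lattice A := toLattice
  wlog h : ¬ x ≤ y generalizing x y
  · obtain ⟨C, hC, f, h₁, h₂, h₃⟩ := this hxy.symm
      (fun h' => hxy (le_antisymm (not_not.1 h) h'))
    exact ⟨C, hC, f, h₁, h₂, h₃.symm⟩
  obtain ⟨I, hI, hxI, hprime⟩ := exists_prime_ideal (mt sub_eq_zero_iff.1 h)
  let _ := hI.quotient
  refine ⟨Quotient hI.setoid, hI.quotient, Quotient.mk _, ?_, ⟨fun _ _ => rfl, fun _ => rfl, rfl⟩,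
    fun h => hxI (Quotient.exact h).1⟩
  -- An inequality in the quotient means exactly that the truncated difference lies in `I`, so
  -- primeness of `I` is totality of the quotient order.
  have key : ∀ a b : A, odot a (neg b) ∈ I → hI.setoid (oplus (neg a) b) one := fun a b h => by
    change odot _ _ ∈ I ∧ odot _ _ ∈ I
    rw [neg_one, odot_zero, odot_comm, odot_one, neg_oplus, neg_neg]
    exact ⟨hI.zero_mem, h⟩
  rintro ⟨a⟩ ⟨b⟩
  exact (hprime a b).imp (fun h => Quotient.sound (key a b h)) fun h => Quotient.sound (key b a h)

end MVAlgebra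

namespace MVAlgebra

/-! ### Chang's ordered group of an MV-chain -/

section ChangGroup

variable {A : Type*} [MVAlgebra A]

local infixl:65 " ∔ " => oplus
local infixl:70 " ⊡ " => odot
attribute [local instance] toLattice

theorem neg_oplus_odot_cancel {x y : A} (h : y ≤ x) : (neg x ∔ y) ⊡ x = y := by
  have := oplus_odot_cancel (x := neg x) (y := y) (by rwa [neg_neg])
  rwa [neg_neg] at this

theorem oplus_odot_exchange {x a b : A} (ha : a ≤ neg x) (hb : b ≤ neg x)
    (h : x ∔ a ∔ b = one) : (x ∔ a) ⊡ b = (x ∔ b) ⊡ a := by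
  rw [oplus_right_comm, oplus_eq_one_iff] at h
  have h₁ := oplus_sub_of_le h
  have h₂ : x ∔ neg (x ∔ b) = neg b := by
    rw [neg_oplus, odot_comm]
    exact oplus_sub_of_le (by simpa only [neg_neg] using neg_le_neg_of_le hb)
  have h₃ : (x ∔ b) ⊡ a ≤ b :=
    odot_le_iff.2 (oplus_le_oplus (by simpa only [neg_neg] using neg_le_neg_of_le ha) le_rfl)
  rw [neg_neg, odot_comm a] at h₁
  have h₄ : x ∔ a = neg b ∔ (x ∔ b) ⊡ a := by
    rw [← h₂, ← oplus_assoc, h₁]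
  rw [h₄]
  exact neg_oplus_odot_cancel h₃

theorem oplus_odot_eq_odot_oplus {x a b : A} (ha : x ∔ a = one) (hb : b ≤ neg x) :
    (x ∔ b) ⊡ a = x ⊡ a ∔ b := by
  have hxa : neg a ≤ x := oplus_eq_one_iff.1 (by rwa [oplus_comm])
  have h₁ := oplus_sub_of_le hxa
  rw [neg_neg] at h₁
  have hba : b ≤ a := hb.trans (oplus_eq_one_iff.1 ha)
  have h₂ : x ⊡ a ∔ b ≤ a := by
    refine le_trans ?_ (oplus_sub_of_le hba).le
    rw [oplus_comm, odot_comm x]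
    exact oplus_le_oplus le_rfl
      (odot_le_odot le_rfl (by simpa only [neg_neg] using neg_le_neg_of_le hb))
  have h₃ : x ∔ b = neg a ∔ (x ⊡ a ∔ b) := by rw [oplus_assoc, h₁]
  rw [h₃]
  exact neg_oplus_odot_cancel h₂

/-- The dual of `oplus_odot_exchange` under negation. -/
theorem odot_oplus_exchange {x a b : A} (ha : x ∔ a = one) (hb : x ∔ b = one)
    (h : x ⊡ a ⊡ b = zero) : x ⊡ a ∔ b = x ⊡ b ∔ a := by
  apply neg_injective
  rw [neg_oplus, neg_oplus, neg_odot, neg_odot]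
  refine oplus_odot_exchange (neg_le_neg_of_le (oplus_eq_one_iff.1 ha))
    (neg_le_neg_of_le (oplus_eq_one_iff.1 hb)) ?_
  rw [← neg_odot, ← neg_odot, h, neg_zero]

open Classical in
/-- The carry in the sum of the fractional parts `x` and `y`. -/
noncomputable def carry (x y : A) : ℤ := if x ∔ y = one then 1 else 0

open Classical in
/-- The fractional part of the sum of the fractional parts `x` and `y`. -/
noncomputable def fracAdd (x y : A) : A := if x ∔ y = one then x ⊡ y else x ∔ y

theorem carry_of_eq {x y : A} (h : x ∔ y = one) : carry x y = 1 := if_pos h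

theorem carry_of_ne {x y : A} (h : x ∔ y ≠ one) : carry x y = 0 := if_neg h

theorem fracAdd_of_eq {x y : A} (h : x ∔ y = one) : fracAdd x y = x ⊡ y := if_pos h

theorem fracAdd_of_ne {x y : A} (h : x ∔ y ≠ one) : fracAdd x y = x ∔ y := if_neg h

theorem fracAdd_ne_one {x y : A} (hx : x ≠ one) : fracAdd x y ≠ one := by
  unfold fracAdd
  split_ifs with h
  · exact fun h' => hx (one_le_iff.1 (h'.ge.trans (odot_le_left x y)))
  · exact h

theorem carry_nonneg (x y : A) : 0 ≤ carry x y := by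
  unfold carry; split_ifs <;> norm_num

theorem carry_comm (x y : A) : carry x y = carry y x := by rw [carry, oplus_comm]; rfl

theorem fracAdd_comm (x y : A) : fracAdd x y = fracAdd y x := by
  rw [fracAdd, oplus_comm, odot_comm]; rfl

theorem IsMVChain.le_neg_of_oplus_ne_one (h : IsMVChain A) {x y : A} (hxy : x ∔ y ≠ one) :
    y ≤ neg x :=
  (h y (neg x)).resolve_right (mt oplus_eq_one_iff.2 hxy)

theorem IsMVChain.oplus_eq_one_of_odot_ne_zero (h : IsMVChain A) {x y : A}
    (hxy : x ⊡ y ≠ zero) : x ∔ y = one := by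
  by_contra hne
  refine hxy ?_
  rw [odot_comm, odot_eq_zero_iff]
  exact h.le_neg_of_oplus_ne_one hne

theorem carry_right_comm_aux (h : IsMVChain A) {x a b : A} (ha₁ : a ≠ one)
    (ha : x ∔ a = one) (hb : x ∔ b ≠ one) :
    carry x a + carry (fracAdd x a) b = carry x b + carry (fracAdd x b) a ∧
      fracAdd (fracAdd x a) b = fracAdd (fracAdd x b) a := by
  have key := oplus_odot_eq_odot_oplus ha (h.le_neg_of_oplus_ne_one hb)
  have h₁ : x ⊡ a ∔ b ≠ one := by
    rw [← key]
    exact fun h' => ha₁ (one_le_iff.1 (h'.ge.trans (odot_le_right _ _)))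
  have h₂ : x ∔ b ∔ a = one := by rw [oplus_right_comm, ha, one_oplus]
  simp only [carry_of_eq ha, fracAdd_of_eq ha, carry_of_ne hb, fracAdd_of_ne hb, carry_of_ne h₁, fracAdd_of_ne h₁, carry_of_eq h₂, fracAdd_of_eq h₂, key]
  simp

/-- This is associativity of Chang's group, given commutativity. The right-commutative form is
symmetric in `a` and `b`, so the cases where only one of `x ∔ a`, `x ∔ b` carries reduce to one. -/
theorem carry_right_comm (h : IsMVChain A) {x a b : A} (ha₁ : a ≠ one) (hb₁ : b ≠ one) :
    carry x a + carry (fracAdd x a) b = carry x b + carry (fracAdd x b) a ∧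
      fracAdd (fracAdd x a) b = fracAdd (fracAdd x b) a := by
  by_cases ha : x ∔ a = one <;> by_cases hb : x ∔ b = one
  · by_cases h₀ : x ⊡ a ⊡ b = zero
    · have key := odot_oplus_exchange ha hb h₀
      rw [carry_of_eq ha, carry_of_eq hb, fracAdd_of_eq ha, fracAdd_of_eq hb, carry, carry,
        fracAdd, fracAdd, key, ← odot_assoc, odot_comm a b, odot_assoc]
      exact ⟨rfl, rfl⟩
    · have h₁ := h.oplus_eq_one_of_odot_ne_zero h₀
      have h₀' : x ⊡ b ⊡ a = x ⊡ a ⊡ b := by rw [← odot_assoc, odot_comm b a, odot_assoc]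
      have h₂ := h.oplus_eq_one_of_odot_ne_zero (h₀'.trans_ne h₀)
      simp only [carry_of_eq ha, fracAdd_of_eq ha, carry_of_eq hb, fracAdd_of_eq hb, carry_of_eq h₁, fracAdd_of_eq h₁, carry_of_eq h₂, fracAdd_of_eq h₂, h₀', and_self]
  · exact carry_right_comm_aux h ha₁ ha hb
  · have := carry_right_comm_aux h hb₁ hb ha
    exact ⟨this.1.symm, this.2.symm⟩
  · by_cases h₁ : x ∔ a ∔ b = one
    · have key := oplus_odot_exchange (h.le_neg_of_oplus_ne_one ha)
        (h.le_neg_of_oplus_ne_one hb) h₁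
      have h₂ : x ∔ b ∔ a = one := by rwa [oplus_right_comm]
      simp only [carry_of_ne ha, fracAdd_of_ne ha, carry_of_ne hb, fracAdd_of_ne hb, carry_of_eq h₁, fracAdd_of_eq h₁, carry_of_eq h₂, fracAdd_of_eq h₂, key, and_self]
    · have h₂ : x ∔ b ∔ a ≠ one := by rwa [oplus_right_comm]
      simp only [carry_of_ne ha, fracAdd_of_ne ha, carry_of_ne hb, fracAdd_of_ne hb, carry_of_ne h₁, fracAdd_of_ne h₁, carry_of_ne h₂, fracAdd_of_ne h₂, true_and]
      rw [oplus_right_comm]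

theorem zero_ne_one [Nontrivial A] : (zero : A) ≠ one := fun h => by
  obtain ⟨x, y, hxy⟩ := exists_pair_ne A
  have key : ∀ z : A, z = zero := fun z => le_zero_iff.1 ((le_one' z).trans_eq h.symm)
  exact hxy ((key x).trans (key y).symm)

variable (A) in
/-- Chang's group of an MV-chain: an element consists of an integer part and a fractional
part different from `1`. -/
@[ext] structure ChangGroup where
  /-- The integer part. -/
  whole : ℤ
  /-- The fractional part. -/
  frac : A
  frac_ne_one : frac ≠ one

namespace ChangGroup

noncomputable instance : Add (ChangGroup A) :=
  ⟨fun p q => ⟨p.whole + q.whole + carry p.frac q.frac, fracAdd p.frac q.frac,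
    fracAdd_ne_one p.frac_ne_one⟩⟩

theorem whole_add (p q : ChangGroup A) :
    (p + q).whole = p.whole + q.whole + carry p.frac q.frac := rfl

theorem frac_add (p q : ChangGroup A) : (p + q).frac = fracAdd p.frac q.frac := rfl

protected theorem add_comm' (p q : ChangGroup A) : p + q = q + p := by
  ext
  · rw [whole_add, whole_add, carry_comm, add_comm p.whole]
  · rw [frac_add, frac_add, fracAdd_comm]

protected theorem add_right_comm' [hA : Fact (IsMVChain A)] (p q r : ChangGroup A) : p + q + r = p + r + q := by
  have := carry_right_comm hA.out (x := p.frac) q.frac_ne_one r.frac_ne_one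
  ext
  · simp only [whole_add, frac_add]
    linarith [this.1]
  · exact this.2

variable [Nontrivial A]

instance : Zero (ChangGroup A) := ⟨⟨0, zero, zero_ne_one⟩⟩

theorem whole_zero : (0 : ChangGroup A).whole = 0 := rfl

theorem frac_zero : (0 : ChangGroup A).frac = zero := rfl

-- For `x ≠ 0`, `-(n + x) = (-n - 1) + (1 - x)`. A zero fractional part is separate because its
-- negation `one` is not an admissible fractional part.
open Classical in
noncomputable instance : Neg (ChangGroup A) :=
  ⟨fun p => if h : p.frac = zero then ⟨-p.whole, zero, zero_ne_one⟩
    else ⟨-p.whole - 1, neg p.frac, fun h' => h (neg_injective h')⟩⟩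

theorem neg_of_frac_eq_zero {p : ChangGroup A} (h : p.frac = zero) :
    -p = ⟨-p.whole, zero, zero_ne_one⟩ := dif_pos h

theorem neg_of_frac_ne_zero {p : ChangGroup A} (h : p.frac ≠ zero) :
    -p = ⟨-p.whole - 1, neg p.frac, fun h' => h (neg_injective h')⟩ := dif_neg h

variable (A) in
/-- The strong unit of Chang's group. -/
def unit : ChangGroup A := ⟨1, zero, zero_ne_one⟩

open Classical in
/-- The embedding of an MV-chain in its Chang group. -/
noncomputable def ofChain (x : A) : ChangGroup A :=
  if h : x = one then unit A else ⟨0, x, h⟩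

theorem ofChain_one : ofChain (one : A) = unit A := dif_pos rfl

theorem ofChain_of_ne_one {x : A} (h : x ≠ one) : ofChain x = ⟨0, x, h⟩ := dif_neg h

theorem ofChain_zero : ofChain (zero : A) = 0 := ofChain_of_ne_one zero_ne_one

theorem ofChain_injective : Function.Injective (ofChain : A → ChangGroup A) := fun x y h => by
  by_cases hx : x = one <;> by_cases hy : y = one
  · rw [hx, hy]
  · rw [hx, ofChain_one, ofChain_of_ne_one hy] at h
    exact absurd (congrArg whole h) (by simp [unit])
  · rw [hy, ofChain_one, ofChain_of_ne_one hx] at h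
    exact absurd (congrArg whole h) (by simp [unit])
  · rw [ofChain_of_ne_one hx, ofChain_of_ne_one hy] at h
    exact congrArg frac h

theorem ofChain_oplus {x y : A} (h : x ∔ y ≠ one) :
    ofChain (x ∔ y) = ofChain x + ofChain y := by
  have hx : x ≠ one := fun hx => h (by rw [hx, one_oplus])
  have hy : y ≠ one := fun hy => h (by rw [hy, oplus_one'])
  rw [ofChain_of_ne_one h, ofChain_of_ne_one hx, ofChain_of_ne_one hy]
  ext
  · simp only [whole_add, carry_of_ne h]; rfl
  · simp only [frac_add, fracAdd_of_ne h]

protected theorem zero_add' (p : ChangGroup A) : 0 + p = p := by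
  have h : zero ∔ p.frac ≠ one := by rw [zero_oplus]; exact p.frac_ne_one
  ext
  · rw [whole_add, whole_zero, frac_zero, carry_of_ne h]; ring
  · rw [frac_add, frac_zero, fracAdd_of_ne h, zero_oplus]

protected theorem neg_add_cancel' (p : ChangGroup A) : -p + p = 0 := by
  by_cases h : p.frac = zero
  · have h' : zero ∔ zero ≠ (one : A) := by rw [zero_oplus]; exact zero_ne_one
    rw [neg_of_frac_eq_zero h]
    ext
    · simp only [whole_add, whole_zero, h, carry_of_ne h']; simp
    · simp only [frac_add, h, fracAdd_of_ne h', zero_oplus]; rfl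
  · rw [neg_of_frac_ne_zero h]
    ext
    · simp only [whole_add, whole_zero, carry_of_eq (neg_oplus_self p.frac)]; ring
    · simp only [frac_add, fracAdd_of_eq (neg_oplus_self p.frac)]
      rw [odot_comm, odot_neg_self]; rfl

variable [Fact (IsMVChain A)]

noncomputable instance : AddCommGroup (ChangGroup A) where
  add_assoc p q r := by
    rw [ChangGroup.add_comm' p q, ChangGroup.add_right_comm', ChangGroup.add_comm' _ p]
  zero_add := ChangGroup.zero_add'
  add_zero p := by rw [ChangGroup.add_comm', ChangGroup.zero_add']
  nsmul := nsmulRec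
  zsmul := zsmulRec
  neg_add_cancel := ChangGroup.neg_add_cancel'
  add_comm := ChangGroup.add_comm'

variable (A) in
/-- The positive cone of Chang's group. -/
def positiveCone : AddGroupCone (ChangGroup A) where
  -- Fractional parts count as nonnegative and less than the unit, so the integer part alone decides
  -- the sign.
  carrier := {p | 0 ≤ p.whole}
  zero_mem' := le_refl (0 : ℤ)
  add_mem' {p q} hp hq := add_nonneg (add_nonneg hp hq) (carry_nonneg _ _)
  eq_zero_of_mem_of_neg_mem' {p} hp hn := by
    simp only [Set.mem_ofPred_eq] at hp hn
    by_cases h : p.frac = zero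
    · rw [neg_of_frac_eq_zero h] at hn
      ext
      · rw [whole_zero]; simp only at hn; omega
      · exact h
    · rw [neg_of_frac_ne_zero h] at hn
      simp only at hn
      omega

instance : HasMemOrNegMem (positiveCone A) where
  mem_or_neg_mem p := by
    change 0 ≤ p.whole ∨ 0 ≤ (-p).whole
    by_cases h : p.frac = zero
    · rw [neg_of_frac_eq_zero h]; simp only; omega
    · rw [neg_of_frac_ne_zero h]; simp only; omega

open Classical in
noncomputable instance : LinearOrder (ChangGroup A) := LinearOrder.mkOfAddGroupCone (positiveCone A)

instance : IsOrderedAddMonoid (ChangGroup A) := IsOrderedAddMonoid.mkOfCone (positiveCone A)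

theorem nonneg_iff {p : ChangGroup A} : 0 ≤ p ↔ 0 ≤ p.whole := by
  change p - 0 ∈ positiveCone A ↔ _
  rw [sub_zero]; rfl

theorem unit_pos : 0 < unit A := by
  refine lt_of_le_of_ne (nonneg_iff.2 Int.one_nonneg) fun h => ?_
  have := congrArg whole h
  exact absurd this.symm (by simp [unit, whole_zero])

theorem ofChain_nonneg (x : A) : 0 ≤ ofChain x := by
  by_cases h : x = one
  · rw [h, ofChain_one]; exact unit_pos.le
  · rw [ofChain_of_ne_one h, nonneg_iff]

/-- The carry contributes one unit. Summands equal to `one` are split off because `ofChain` encodes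
them by an integer part. -/
theorem ofChain_add_of_oplus_eq_one {x y : A} (h : x ∔ y = one) :
    ofChain x + ofChain y = unit A + ofChain (x ⊡ y) := by
  by_cases hx : x = one
  · rw [hx, ofChain_one, odot_comm, odot_one]
  by_cases hy : y = one
  · rw [hy, ofChain_one, odot_one, add_comm]
  have hxy : x ⊡ y ≠ one := fun h' => hx (one_le_iff.1 (h'.ge.trans (odot_le_left x y)))
  have h₀ : zero ∔ x ⊡ y ≠ one := by rwa [zero_oplus]
  rw [ofChain_of_ne_one hx, ofChain_of_ne_one hy, ofChain_of_ne_one hxy, unit]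
  ext
  · simp only [whole_add, carry_of_eq h, carry_of_ne h₀]; norm_num
  · simp only [frac_add, fracAdd_of_eq h, fracAdd_of_ne h₀, zero_oplus]

theorem ofChain_add_neg (x : A) : ofChain x + ofChain (neg x) = unit A := by
  rw [ofChain_add_of_oplus_eq_one (oplus_neg_self x), odot_neg_self, ofChain_zero, add_zero]

theorem unit_le_of_oplus_eq_one {x y : A} (h : x ∔ y = one) :
    unit A ≤ ofChain x + ofChain y := by
  rw [ofChain_add_of_oplus_eq_one h]
  exact le_add_of_nonneg_right (ofChain_nonneg _)

theorem ofChain_le_unit (x : A) : ofChain x ≤ unit A := by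
  rw [← ofChain_add_neg x]
  exact le_add_of_nonneg_right (ofChain_nonneg _)

end ChangGroup

end ChangGroup

end MVAlgebra

/-! ### Transfer of finitely many inequalities to the rationals -/

/-- A finite system of strict linear inequalities with integer coefficients that is solvable
in some linearly ordered abelian group is solvable in `ℚ`. -/
theorem exists_rat_solution {G : Type*} [AddCommGroup G] [LinearOrder G] [IsOrderedAddMonoid G] :
    ∀ (n : ℕ) (P : Finset (Fin n → ℤ)) (v : Fin n → G), (∀ p ∈ P, 0 < ∑ i, p i • v i) →
      ∃ q : Fin n → ℚ, ∀ p ∈ P, 0 < ∑ i, (p i : ℚ) * q i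
  | 0, P, v, h => ⟨0, fun p hp => by simpa using h p hp⟩
  | n + 1, P, v, h => by
    classical
    -- Fourier–Motzkin elimination of variable `0`: `Z` keeps the inequalities not involving it, and
    -- `E` holds the positive combinations of pairs with opposite signs in which it cancels.
    set Z := (P.filter fun p => p 0 = 0).image Fin.tail
    set E := ((P.filter fun p => 0 < p 0) ×ˢ (P.filter fun p => p 0 < 0)).image
      fun r => fun i : Fin n => -(r.2 0) * r.1 i.succ + r.1 0 * r.2 i.succ
    obtain ⟨q, hq⟩ := exists_rat_solution n (Z ∪ E) (fun i => v i.succ) (by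
      intro p hp
      rcases Finset.mem_union.1 hp with hp | hp
      · obtain ⟨r, hr, rfl⟩ := Finset.mem_image.1 hp
        obtain ⟨hr, hr0⟩ := Finset.mem_filter.1 hr
        have := h r hr
        rw [Fin.sum_univ_succ, hr0, zero_smul, zero_add] at this
        exact this
      · obtain ⟨⟨r, s⟩, hrs, rfl⟩ := Finset.mem_image.1 hp
        simp only [Finset.mem_product, Finset.mem_filter] at hrs
        obtain ⟨⟨hr, hr0⟩, hs, hs0⟩ := hrs
        have h₁ := zsmul_pos (h r hr) (neg_pos.2 hs0)
        have h₂ := zsmul_pos (h s hs) hr0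
        have h₃ := add_pos h₁ h₂
        rw [Fin.sum_univ_succ, Fin.sum_univ_succ, smul_add, smul_add] at h₃
        simp only [add_smul, mul_smul, Finset.sum_add_distrib, ← Finset.smul_sum]
        refine lt_of_lt_of_eq h₃ ?_
        simp only [← mul_smul]
        have : (-s 0 * r 0) • v 0 + (r 0 * s 0) • v 0 = 0 := by
          rw [← add_smul]; ring_nf; simp
        rw [add_add_add_comm, this, zero_add])
    -- `f p` is the bound that `p` puts on variable `0`, from below if `p 0 > 0` and from above if
    -- `p 0 < 0`. The inequalities of `E` say that every lower bound is less than every upper bound.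
    set f : (Fin (n + 1) → ℤ) → ℚ := fun p => -(∑ i : Fin n, (p i.succ : ℚ) * q i) / p 0
    obtain ⟨m, hm₁, hm₂⟩ := Order.exists_between_finsets
      ((P.filter fun p => 0 < p 0).image f) ((P.filter fun p => p 0 < 0).image f) (by
        intro x hx y hy
        obtain ⟨r, hr, rfl⟩ := Finset.mem_image.1 hx
        obtain ⟨s, hs, rfl⟩ := Finset.mem_image.1 hy
        have := hq _ (Finset.mem_union_right _ (Finset.mem_image_of_mem _
          (Finset.mk_mem_product hr hs)))
        have hr0 : (0 : ℚ) < r 0 := by exact_mod_cast (Finset.mem_filter.1 hr).2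
        have hs0 : (s 0 : ℚ) < 0 := by exact_mod_cast (Finset.mem_filter.1 hs).2
        push_cast at this
        simp only [add_mul, mul_assoc, Finset.sum_add_distrib, ← Finset.mul_sum] at this
        simp only [f]
        rw [div_lt_iff₀ hr0, div_mul_eq_mul_div, lt_div_iff_of_neg hs0]
        linarith)
    refine ⟨Fin.cons m q, fun p hp => ?_⟩
    rw [Fin.sum_univ_succ]
    simp only [Fin.cons_zero, Fin.cons_succ]
    rcases lt_trichotomy (p 0) 0 with h0 | h0 | h0
    · have := hm₂ _ (Finset.mem_image_of_mem f (Finset.mem_filter.2 ⟨hp, h0⟩))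
      have h0' : (p 0 : ℚ) < 0 := by exact_mod_cast h0
      rw [lt_div_iff_of_neg h0'] at this
      linarith
    · have := hq _ (Finset.mem_union_left _ (Finset.mem_image_of_mem _
        (Finset.mem_filter.2 ⟨hp, h0⟩)))
      rw [h0, Int.cast_zero, zero_mul, zero_add]
      exact this
    · have := hm₁ _ (Finset.mem_image_of_mem f (Finset.mem_filter.2 ⟨hp, h0⟩))
      have h0' : (0 : ℚ) < p 0 := by exact_mod_cast h0
      rw [div_lt_iff₀ h0'] at this
      linarith

/-- Finitely many positive elements of a linearly ordered abelian group are positive under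
some additive map to `ℚ`. -/
theorem exists_addMonoidHom_rat_pos {G : Type*} [AddCommGroup G] [LinearOrder G]
    [IsOrderedAddMonoid G] (T : Finset G) : ∃ φ : G →+ ℚ, ∀ t ∈ T, 0 < t → 0 < φ t := by
  classical
  set W := Submodule.span ℤ (T : Set G)
  have : Module.Finite ℤ W := Module.Finite.span_of_finite ℤ T.finite_toSet
  -- A linearly ordered group is torsion-free, so its finitely generated subgroups are free and a
  -- basis provides the variables of the system.
  have : Module.Free ℤ W := inferInstance
  let b := Module.finBasis ℤ W
  let T' : Finset W := (T.attach.image fun t => ⟨t.1, Submodule.subset_span t.2⟩).filter fun w =>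
    (0 : G) < w
  obtain ⟨q, hq⟩ := exists_rat_solution _ (T'.image fun w i => b.repr w i) (fun i => (b i : G)) (by
    intro p hp
    obtain ⟨w, hw, rfl⟩ := Finset.mem_image.1 hp
    have h := congrArg (Subtype.val : W → G) (b.sum_repr w)
    simp only [Submodule.coe_sum, Submodule.coe_smul] at h
    rw [h]
    exact (Finset.mem_filter.1 hw).2)
  -- Divisibility makes `ℚ` injective, so the map on `W` extends to the whole group.
  obtain ⟨φ, hφ⟩ := (Module.Baer.of_divisible ℚ).extension_property_addMonoidHom
    W.subtype.toAddMonoidHom Subtype.val_injective (b.constr ℤ q).toAddMonoidHom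
  refine ⟨φ, fun t ht h0 => ?_⟩
  let w : W := ⟨t, Submodule.subset_span ht⟩
  have hw : w ∈ T' := Finset.mem_filter.2
    ⟨Finset.mem_image.2 ⟨⟨t, ht⟩, Finset.mem_attach _ _, rfl⟩, h0⟩
  have h₁ : φ t = b.constr ℤ q w := DFunLike.congr_fun hφ w
  rw [h₁, Module.Basis.constr_apply_fintype]
  simpa [Module.Basis.equivFun_apply] using hq _ (Finset.mem_image_of_mem _ hw)

/-- Finitely many rational numbers have a common denominator. -/
theorem exists_common_denominator (T : Finset ℚ) :
    ∃ N : ℕ, 0 < N ∧ ∀ t ∈ T, ∃ m : ℤ, (N : ℚ) * t = m := by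
  classical
  refine ⟨∏ t ∈ T, t.den, Finset.prod_pos fun t _ => t.den_pos, fun t ht => ?_⟩
  obtain ⟨k, hk⟩ := Finset.dvd_prod_of_mem Rat.den ht
  refine ⟨k * t.num, ?_⟩
  rw [hk]
  push_cast
  rw [mul_comm (t.den : ℚ), mul_assoc, Rat.den_mul_eq_num]

/-! ### Finite chains and partial embeddings of MV-chains -/

namespace MVAlgebra

/-- The finite Łukasiewicz chain `{0, …, n}`, on `n + 1` elements. -/
def LukChain (n : ℕ) : Type := {k : ℕ // k ≤ n}

namespace LukChain

variable {n : ℕ}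

instance : MVAlgebra (LukChain n) where
  oplus x y := ⟨min (x.1 + y.1) n, min_le_right _ _⟩
  neg x := ⟨n - x.1, Nat.sub_le _ _⟩
  zero := ⟨0, Nat.zero_le _⟩
  oplus_comm x y := Subtype.ext (by simp only; omega)
  oplus_assoc x y z := Subtype.ext (by simp only; omega)
  oplus_zero x := Subtype.ext (by have := x.2; simp only; omega)
  neg_neg x := Subtype.ext (by have := x.2; simp only; omega)
  oplus_one x := Subtype.ext (by simp only; omega)
  lukasiewicz x y := Subtype.ext (by have := x.2; have := y.2; simp only; omega)

theorem val_oplus (x y : LukChain n) : (oplus x y).1 = min (x.1 + y.1) n := rfl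

theorem val_neg (x : LukChain n) : (neg x).1 = n - x.1 := rfl

theorem val_zero : (zero : LukChain n).1 = 0 := rfl

theorem val_one : (one : LukChain n).1 = n := rfl

instance : Finite (LukChain n) := (Set.finite_Iic n).to_subtype

theorem isMVChain : IsMVChain (LukChain n) := fun x y => by
  have key : ∀ x y : LukChain n, x.1 ≤ y.1 → le x y := fun x y h => Subtype.ext (by
    rw [val_oplus, val_neg, val_one]
    have := x.2
    omega)
  exact (le_total x.1 y.1).imp (key x y) (key y x)

end LukChain

/-- `g` respects the operations of `A` as far as they are defined on `S`. -/
structure IsPartialHomOn {A B : Type*} [MVAlgebra A] [MVAlgebra B] (g : A → B) (S : Set A) :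
    Prop where
  map_oplus : ∀ x ∈ S, ∀ y ∈ S, oplus x y ∈ S → g (oplus x y) = oplus (g x) (g y)
  map_neg : ∀ x ∈ S, neg x ∈ S → g (neg x) = neg (g x)
  map_zero : zero ∈ S → g zero = zero

open ChangGroup in
/-- Finite parts of a nontrivial MV-chain embed in finite chains. -/
theorem IsMVChain.exists_partial_embedding {A : Type*} [MVAlgebra A] [Nontrivial A]
    (hA : IsMVChain A) (S : Finset A) :
    ∃ N : ℕ, 0 < N ∧ ∀ k : ℕ, 0 < k → ∃ g : A → LukChain (N * k),
      IsPartialHomOn g S ∧ Set.InjOn g S := by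
  classical
  have : Fact (IsMVChain A) := ⟨hA⟩
  -- The signs to be preserved: the unit; the bounds `0` and `u` on each element; differences, for
  -- injectivity; and `x + y - u`, for truncated sums.
  let T : Finset (ChangGroup A) := {unit A} ∪ (S.image ofChain ∪ S.image (unit A - ofChain ·)) ∪
    ((S ×ˢ S).image (fun r => ofChain r.1 - ofChain r.2) ∪
      (S ×ˢ S).image fun r => ofChain r.1 + ofChain r.2 - unit A)
  obtain ⟨φ, hφ⟩ := exists_addMonoidHom_rat_pos T
  have hnonneg : ∀ t ∈ T, 0 ≤ t → 0 ≤ φ t := fun t ht h => by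
    rcases h.eq_or_lt with rfl | h
    · rw [map_zero]
    · exact (hφ t ht h).le
  have hu : 0 < φ (unit A) := hφ _ (by simp [T]) unit_pos
  set f : A → ℚ := fun x => φ (ofChain x) / φ (unit A) with hf
  have f0 : ∀ x ∈ S, 0 ≤ f x := fun x hx => div_nonneg
    (hnonneg _ (Finset.mem_union_left _ (Finset.mem_union_right _ (Finset.mem_union_left _
      (Finset.mem_image_of_mem _ hx)))) (ofChain_nonneg x)) hu.le
  have f1 : ∀ x ∈ S, f x ≤ 1 := fun x hx => by
    rw [hf, div_le_one hu, ← sub_nonneg, ← map_sub]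
    exact hnonneg _ (Finset.mem_union_left _ (Finset.mem_union_right _ (Finset.mem_union_right _
      (Finset.mem_image_of_mem _ hx)))) (sub_nonneg.2 (ofChain_le_unit x))
  have fone : f one = 1 := by rw [hf]; simp only [ofChain_one]; exact div_self hu.ne'
  have fzero : f zero = 0 := by simp only [hf, ofChain_zero, map_zero, zero_div]
  have fneg : ∀ x, f (neg x) = 1 - f x := fun x => by
    have := congrArg φ (ofChain_add_neg x)
    rw [map_add] at this
    simp only [hf]
    rw [eq_sub_iff_add_eq, ← add_div, add_comm, this, div_self hu.ne']
  have flt : ∀ x y, oplus x y ≠ one → f (oplus x y) = f x + f y := fun x y h => by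
    simp only [hf]
    rw [ofChain_oplus h, map_add, add_div]
  have fge : ∀ x ∈ S, ∀ y ∈ S, oplus x y = one → 1 ≤ f x + f y := fun x hx y hy h => by
    simp only [hf]
    rw [← add_div, one_le_div hu, ← sub_nonneg, ← map_add, ← map_sub]
    exact hnonneg _ (Finset.mem_union_right _ (Finset.mem_union_right _
      (Finset.mem_image_of_mem (fun r : A × A => ofChain r.1 + ofChain r.2 - unit A)
        (Finset.mk_mem_product hx hy)))) (sub_nonneg.2 (unit_le_of_oplus_eq_one h))
  have finj : ∀ x ∈ S, ∀ y ∈ S, f x = f y → x = y := by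
    have key : ∀ x ∈ S, ∀ y ∈ S, f x = f y → ofChain x ≤ ofChain y := fun x hx y hy h => by
      by_contra! hlt
      have := hφ _ (Finset.mem_union_right _ (Finset.mem_union_left _
        (Finset.mem_image_of_mem (fun r : A × A => ofChain r.1 - ofChain r.2)
          (Finset.mk_mem_product hx hy)))) (sub_pos.2 hlt)
      simp only [hf] at h
      rw [map_sub, (div_left_inj' hu.ne').1 h, sub_self] at this
      exact this.false
    exact fun x hx y hy h => ofChain_injective
      (le_antisymm (key x hx y hy h) (key y hy x hx h.symm))
  obtain ⟨N, hN, hden⟩ := exists_common_denominator (S.image f)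
  -- Every multiple of `N` clears the denominators too; this freedom later lets different chains
  -- share one target.
  refine ⟨N, hN, fun k hk => ?_⟩
  have hNk : (0 : ℚ) < (N * k : ℕ) := by exact_mod_cast Nat.mul_pos hN hk
  -- The floor and the minimum only make `g` total; on `S` the value is exactly `N * k * f x`, by
  -- `hg`.
  let g : A → LukChain (N * k) := fun x =>
    ⟨min ⌊((N * k : ℕ) : ℚ) * f x⌋₊ (N * k), min_le_right _ _⟩
  have hg : ∀ x ∈ S, ((g x).1 : ℚ) = (N * k : ℕ) * f x := fun x hx => by
    obtain ⟨m, hm⟩ := hden _ (Finset.mem_image_of_mem f hx)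
    have hm' : ((N * k : ℕ) : ℚ) * f x = ((k * m : ℤ) : ℚ) := by
      push_cast; rw [← hm]; ring
    have hm0 : 0 ≤ (k * m : ℤ) := by
      have : (0 : ℚ) ≤ ((k * m : ℤ) : ℚ) := hm' ▸ mul_nonneg hNk.le (f0 x hx)
      exact_mod_cast this
    obtain ⟨l, hl⟩ := Int.eq_ofNat_of_zero_le hm0
    rw [hl, Int.cast_natCast] at hm'
    have hle : l ≤ N * k := by
      have : (l : ℚ) ≤ (N * k : ℕ) := by
        rw [← hm']; exact mul_le_of_le_one_right hNk.le (f1 x hx)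
      exact_mod_cast this
    change ((min ⌊((N * k : ℕ) : ℚ) * f x⌋₊ (N * k) : ℕ) : ℚ) = _
    rw [hm', Nat.floor_natCast, min_eq_left hle]
  refine ⟨g, ⟨fun x hx y hy hxy => Subtype.ext ?_, fun x hx hnx => Subtype.ext ?_,
    fun h0 => Subtype.ext ?_⟩, fun x hx y hy h => finj x hx y hy ?_⟩
  · rw [LukChain.val_oplus]
    have e : (((g x).1 + (g y).1 : ℕ) : ℚ) = (N * k : ℕ) * (f x + f y) := by
      rw [Nat.cast_add, hg x hx, hg y hy]; ring
    have e' := hg _ hxy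
    by_cases h : oplus x y = one
    · rw [h, fone, mul_one] at e'
      have : N * k ≤ (g x).1 + (g y).1 := by
        have : ((N * k : ℕ) : ℚ) ≤ (((g x).1 + (g y).1 : ℕ) : ℚ) := by
          rw [e]; exact le_mul_of_one_le_right hNk.le (fge x hx y hy h)
        exact_mod_cast this
      rw [min_eq_right this, h]
      exact_mod_cast e'
    · rw [flt x y h, ← e] at e'
      have e'' : (g (oplus x y)).1 = (g x).1 + (g y).1 := by exact_mod_cast e'
      rw [← e'', min_eq_left (g (oplus x y)).2]
  · rw [LukChain.val_neg]
    have : (((g (neg x)).1 + (g x).1 : ℕ) : ℚ) = (N * k : ℕ) := by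
      rw [Nat.cast_add, hg _ hnx, hg x hx, fneg]; ring
    have : (g (neg x)).1 + (g x).1 = N * k := by exact_mod_cast this
    omega
  · have := hg _ h0
    rw [fzero, mul_zero] at this
    rw [LukChain.val_zero]
    exact_mod_cast this
  · have := hg x hx
    rw [h, hg y hy] at this
    exact (mul_left_cancel₀ hNk.ne' this).symm

end MVAlgebra

/-! ### Partial embeddings into powers, and ultraproducts -/

namespace MVAlgebra

/-- Every finite part of an MV-chain embeds in a finite chain. -/
theorem IsMVChain.exists_partial_embedding_lukChain {A : Type*} [MVAlgebra A]
    (hA : IsMVChain A) (S : Finset A) :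
    ∃ (n : ℕ) (g : A → LukChain n), IsPartialHomOn g S ∧ Set.InjOn g S := by
  -- Chang's group needs `zero ≠ one`, so the one-element algebra goes to the one-element chain
  -- directly.
  rcases subsingleton_or_nontrivial A with h | h
  · have h₀ : ∀ x y : LukChain 0, x = y := fun x y =>
      Subtype.ext ((Nat.le_zero.1 x.2).trans (Nat.le_zero.1 y.2).symm)
    exact ⟨0, fun _ => zero, ⟨fun _ _ _ _ _ => h₀ _ _, fun _ _ _ => h₀ _ _, fun _ => rfl⟩,
      fun x _ y _ _ => h.elim x y⟩
  · obtain ⟨N, -, hN⟩ := hA.exists_partial_embedding S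
    exact ⟨N * 1, hN 1 one_pos⟩

theorem IsPartialHomOn.comp_isHom {A B C : Type*} [MVAlgebra A] [MVAlgebra B] [MVAlgebra C]
    {g : B → C} {f : A → B} {S : Set A} {T : Set B} (hg : IsPartialHomOn g T) (hf : IsHom f)
    (hST : Set.MapsTo f S T) : IsPartialHomOn (g ∘ f) S where
  map_oplus x hx y hy hxy := by
    have h := hST hxy
    rw [hf.map_oplus] at h
    simp only [Function.comp_apply]
    rw [hf.map_oplus, hg.map_oplus _ (hST hx) _ (hST hy) h]
  map_neg x hx hnx := by
    have h := hST hnx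
    rw [hf.map_neg] at h
    simp only [Function.comp_apply]
    rw [hf.map_neg, hg.map_neg _ (hST hx) h]
  map_zero h := by
    have h := hST h
    rw [hf.map_zero] at h
    simp only [Function.comp_apply]
    rw [hf.map_zero, hg.map_zero h]

/-- Every finite part of an MV-algebra embeds in a finite power of a finite chain. -/
theorem exists_partial_embedding_power {A : Type u} [MVAlgebra A] (S : Finset A) :
    ∃ (m n : ℕ) (g : A → Fin m → LukChain n), IsPartialHomOn g S ∧ Set.InjOn g S := by
  classical
  let P := {p : S × S // p.1 ≠ p.2}
  have key : ∀ p : P, ∃ N : ℕ, 0 < N ∧ ∀ k : ℕ, 0 < k → ∃ g : A → LukChain (N * k),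
      IsPartialHomOn g S ∧ g p.1.1 ≠ g p.1.2 := fun p => by
    obtain ⟨C, hC, f, hchain, hf, hne⟩ := exists_isHom_chain_ne
      (fun h => p.2 (Subtype.ext h) : (p.1.1 : A) ≠ p.1.2)
    have : Nontrivial C := ⟨_, _, hne⟩
    obtain ⟨N, hN, h⟩ := hchain.exists_partial_embedding (S.image f)
    refine ⟨N, hN, fun k hk => ?_⟩
    obtain ⟨g, hg, hinj⟩ := h k hk
    have hmaps : Set.MapsTo f (S : Set A) (S.image f : Finset C) := fun x hx =>
      Finset.mem_image_of_mem f hx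
    exact ⟨g ∘ f, hg.comp_isHom hf hmaps,
      fun h => hne (hinj (hmaps p.1.1.2) (hmaps p.1.2.2) h)⟩
  choose N hN hg using key
  have key' : ∀ p : P, ∃ g : A → LukChain (∏ p, N p),
      IsPartialHomOn g S ∧ g p.1.1 ≠ g p.1.2 := fun p => by
    -- Multiplying `N p` by all the other denominators makes the target chain independent of `p`.
    have := hg p (∏ q ∈ Finset.univ.erase p, N q) (Finset.prod_pos fun q _ => hN q)
    rwa [Finset.mul_prod_erase Finset.univ N (Finset.mem_univ p)] at this
  choose g hg hne using key'
  let e := Fintype.equivFin P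
  refine ⟨Fintype.card P, ∏ p, N p, fun x i => g (e.symm i) x,
    ⟨fun x hx y hy hxy => funext fun i => (hg _).map_oplus x hx y hy hxy,
      fun x hx hnx => funext fun i => (hg _).map_neg x hx hnx,
      fun h => funext fun i => (hg _).map_zero h⟩, fun x hx y hy h => ?_⟩
  by_contra hxy
  let p : P := ⟨(⟨x, hx⟩, ⟨y, hy⟩), fun h => hxy (congrArg Subtype.val h)⟩
  have := congrFun h (e p)
  simp only [e.symm_apply_apply] at this
  exact hne p this

/-- An MV-algebra all of whose finite parts embed in members of a family embeds in an
ultraproduct of the family. -/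
theorem embedsInto_ultraproduct {A : Type u} [MVAlgebra A] (B : Finset A → Type)
    [∀ S, MVAlgebra (B S)] (g : ∀ S, A → B S)
    (hg : ∀ S : Finset A, IsPartialHomOn (g S) (S : Set A) ∧ Set.InjOn (g S) S) :
    EmbedsInto A (Ultraproduct (Ultrafilter.of (Filter.atTop : Filter (Finset A))) B) := by
  classical
  set U := Ultrafilter.of (Filter.atTop : Filter (Finset A))
  -- The sets of `S` containing `x` belong to `atTop`, hence to any finer ultrafilter.
  have hU : ∀ x : A, ∀ᶠ S in (U : Filter (Finset A)), x ∈ S := fun x => by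
    refine Ultrafilter.of_le _ ?_
    filter_upwards [Filter.eventually_ge_atTop {x}] with S hS
    exact hS (Finset.mem_singleton_self x)
  refine ⟨fun x => Quotient.mk ((U : Filter (Finset A)).productSetoid B) fun S => g S x,
    fun x y h => ?_, fun x y => Quotient.sound ?_, fun x => Quotient.sound ?_, Quotient.sound ?_⟩
  · have h' : ∀ᶠ S in (U : Filter (Finset A)), g S x = g S y := Quotient.exact h
    obtain ⟨S, hS, hx, hy⟩ := (h'.and ((hU x).and (hU y))).exists
    exact (hg S).2 hx hy hS
  · filter_upwards [hU x, hU y, hU (oplus x y)] with S hx hy hxy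
    exact (hg S).1.map_oplus x hx y hy hxy
  · filter_upwards [hU x, hU (neg x)] with S hx hnx
    exact (hg S).1.map_neg x hx hnx
  · filter_upwards [hU zero] with S h
    exact (hg S).1.map_zero h

/-- MV-chains embed in ultraproducts of finite chains. -/
theorem IsMVChain.exists_embedsInto_ultraproduct {A : Type u} [MVAlgebra A] (hA : IsMVChain A) :
    ∃ (I : Type u) (U : Ultrafilter I) (B : I → Type) (_ : ∀ i, MVAlgebra (B i)),
      (∀ i, Finite (B i) ∧ IsMVChain (B i)) ∧ EmbedsInto A (Ultraproduct U B) := by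
  choose n g hg using hA.exists_partial_embedding_lukChain
  exact ⟨Finset A, _, fun S => LukChain (n S), inferInstance,
    fun S => ⟨inferInstance, LukChain.isMVChain⟩, embedsInto_ultraproduct _ g hg⟩

end MVAlgebra


theorem theorem6 :
    -- (1)
    (∀ (M : Type u) [MVAlgebra M], MVAlgebra.IsMVChain M →
      ∃ (I : Type u) (U : Ultrafilter I) (A : I → Type) (_ : ∀ i, MVAlgebra (A i)),
        (∀ i, Finite (A i) ∧ MVAlgebra.IsMVChain (A i)) ∧
        MVAlgebra.EmbedsInto M (MVAlgebra.Ultraproduct U A)) ∧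
    -- (2)
    (∀ (M : Type u) [MVAlgebra M],
      ∃ (J : Type u) (I : J → Type u) (U : ∀ j, Ultrafilter (I j))
        (A : ∀ j, I j → Type) (_ : ∀ j i, MVAlgebra (A j i)),
        (∀ j i, Finite (A j i) ∧ MVAlgebra.IsMVChain (A j i)) ∧
        MVAlgebra.EmbedsInto M (∀ j, MVAlgebra.Ultraproduct (U j) (A j))) ∧
    -- (3)
    (∀ (M : Type u) [MVAlgebra M],
      ∃ (I : Type u) (U : Ultrafilter I) (A : I → Type) (_ : ∀ i, MVAlgebra (A i)),
        (∀ i, Finite (A i) ∧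
          ∃ (C : Type) (_ : MVAlgebra C) (K : Type),
            Finite C ∧ MVAlgebra.IsMVChain C ∧ MVAlgebra.EmbedsInto (A i) (K → C)) ∧
        MVAlgebra.EmbedsInto M (MVAlgebra.Ultraproduct U A)) := by
  refine ⟨fun M _ hM => hM.exists_embedsInto_ultraproduct, fun M _ => ?_, fun M _ => ?_⟩
  -- One factor for each pair of distinct points, so that the product map is injective.
  · choose C hC f hchain hf hne using
      fun j : {p : M × M // p.1 ≠ p.2} => MVAlgebra.exists_isHom_chain_ne j.2
    choose I U A hA hfin e he using fun j => (hchain j).exists_embedsInto_ultraproduct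
    refine ⟨_, I, U, A, hA, hfin, fun x j => e j (f j x), fun x y h => ?_,
      fun x y => funext fun j => ?_, fun x => funext fun j => ?_, funext fun j => ?_⟩
    · by_contra hxy
      exact hne ⟨(x, y), hxy⟩ ((he _).injective (congrFun h ⟨(x, y), hxy⟩))
    · rw [(hf j).map_oplus, (he j).map_oplus]
      rfl
    · rw [(hf j).map_neg, (he j).map_neg]
      rfl
    · rw [(hf j).map_zero, (he j).map_zero]
      rfl
  · choose m n g hg using MVAlgebra.exists_partial_embedding_power (A := M)
    -- The members of the family are themselves finite powers of finite chains, so the identity is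
    -- the required embedding.
    exact ⟨Finset M, _, fun S => Fin (m S) → MVAlgebra.LukChain (n S), inferInstance,
      fun S => ⟨inferInstance, MVAlgebra.LukChain (n S), inferInstance, Fin (m S), inferInstance,
        MVAlgebra.LukChain.isMVChain, id, Function.injective_id, fun _ _ => rfl, fun _ => rfl, rfl⟩,
      MVAlgebra.embedsInto_ultraproduct _ g hg⟩
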